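/- Let $m^\pm\ge 1$ be integers and let $\alpha_0^\pm,\beta_0^\pm,\alpha_i^\pm,\beta_i^\pm\in\mathbb R$ and $\eta_i^\pm\in[-1,1]$, $\eta_i^\pm\neq\pm1$ $(i=1,\dots,m^\pm)$, be given, so that all $\eta_i^+\in[-1,1)$ and all $\eta_i^-\in(-1,1]$. Consider the real eigenvalue problem $$-u''=\lambda u\ \text{ on }(-1,1),\qquad \alpha_0^\pm u(\pm1)+\beta_0^\pm u'(\pm1)=\sum_{i=1}^{m^\pm}\alpha_i^\pm u(\eta_i^\pm)+\sum_{i=1}^{m^\pm}\beta_i^\pm u'(\eta_i^\pm),\qquad(\ast)$$ for $\lambda\in\mathbb R$ and real-valued $u\in C^2[-1,1]$. An eigenvalue is a number $\lambda\in\mathbb R$ for which $(\ast)$ has a solution $u\not\equiv0$ (an eigenfunction); its geometric multiplicity is the dimension of the real vector space of all solutions of $(\ast)$; the spectrum $\sigma$ is the set of all eigenvalues. Assume that, for both signs, $$\alpha_0^\pm\ge0,\quad \alpha_0^\pm+|\beta_0^\pm|>0,\qquad(3)$$ $$\pm\beta_0^\pm\ge0,\qquad(4)$$ $$\left(\frac{\sum_{i}|\alpha_i^\pm|}{\alpha_0^\pm}\right)^2+\left(\frac{\sum_{i}|\beta_i^\pm|}{\beta_0^\pm}\right)^2<1,\qquad(5)$$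 where, if a denominator in (5) is zero, the corresponding numerator is required to be zero too and the fraction is omitted. For $\lambda>0$ and a function $u\in C^1[-1,1]$ having only simple zeros (that is, $|u(x)|+|u'(x)|>0$ for all $x\in[-1,1]$), the modified Prüfer angle $\omega_{(\lambda,u)}\in C^0[-1,1]$ is the angle from the vector $(1,0)$ to the vector $(u'(x),\lambda^{1/2}u(x))$ in $\mathbb R^2$, chosen continuously in $x\in[-1,1]$ and with $\omega_{(\lambda,u)}(-1)\in(-\pi,\pi]$. Put $$\omega_{\lambda,0}^-=-\tan^{-1}\frac{\lambda^{1/2}\beta_0^-}{\alpha_0^-}\in[0,\tfrac{\pi}{2}],\qquad \omega_{\lambda,0}^+=-\tan^{-1}\frac{\lambda^{1/2}\beta_0^+}{\alpha_0^+}\in[\tfrac{\pi}{2},\pi],$$ with the branches of $\tan^{-1}$ that lie in the ranges shown (and the value $\pi/2$ if the denominator is zero). For integers $k\ge0$ let $P_k^+$ be the set of all $(\lambda,u)$ such that $\lambda>0$, $u\in C^1[-1,1]$ has only simple zeros, and $$|\omega_{(\lambda,u)}(-1)-\omega_{\lambda,0}^-|<\tfrac{\pi}{2},\qquad |\omega_{(\lambda,u)}(1)-\omega_{\lambda,0}^+-k\pi|<\tfrac{\pi}{2}.$$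 Then $\sigma$ consists of a strictly increasing sequence of eigenvalues $\lambda_k\ge0$, $k=0,1,\dots$, such that $\lim_{k\to\infty}\lambda_k=\infty$. For each $k\ge0$, $\lambda_k$ has geometric multiplicity $1$; and for each $k\ge0$ with $\lambda_k>0$, $\lambda_k$ has an eigenfunction $u_k$ such that $(\lambda_k,u_k)\in P_k^+$. In the Neumann-type case $\alpha_0^-=\alpha_0^+=0$ one has $\lambda_0=0$, while if $\alpha_0^-+\alpha_0^+>0$ then $\lambda_0>0$. (Thus $\lambda_k>0$ for all $k\ge0$, except for $k=0$ in the Neumann-type case.) -/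

import Mathlib

namespace MultiPoint

open Set

/-- The closed interval `[-1,1]`, as a type. -/
abbrev J : Type := Icc (-1 : ℝ) 1

/-- The end point `-1`. -/
def leftEnd : J := ⟨-1, by norm_num, by norm_num⟩

/-- The end point `1`. -/
def rightEnd : J := ⟨1, by norm_num, by norm_num⟩

/-- A function on `[-1,1]`, extended to the real line (constantly on each side).
Only derivatives relative to `[-1,1]` of the extension are used. -/
noncomputable def ext (u : J → ℝ) : ℝ → ℝ := IccExtend (by norm_num : (-1 : ℝ) ≤ 1) u

/-- `u ∈ C^n[-1,1]`. -/
def IsC (n : ℕ) (u : J → ℝ) : Prop := ContDiffOn ℝ n (ext u) (Icc (-1) 1)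

/-- The derivative of a function on `[-1,1]` (one-sided at the end points). -/
noncomputable def D (u : J → ℝ) : J → ℝ := fun x => derivWithin (ext u) (Icc (-1) 1) x

/-- The data of a multi-point condition at the end point `e`:
`α₀ u(e) + β₀ u'(e) = ∑ α i u(η i) + ∑ β i u'(η i)`,
with `m ≥ 1` points `η i ∈ [-1,1]`, all different from `e`. -/
structure Condition (e : J) where
  m : ℕ
  one_le_m : 1 ≤ m
  α₀ : ℝ
  β₀ : ℝ
  α : Fin m → ℝ
  β : Fin m → ℝ
  η : Fin m → J
  η_ne : ∀ i, η i ≠ e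

namespace Condition

variable {e : J}

/-- The function `u` satisfies the multi-point boundary condition `b`. -/
def Holds (b : Condition e) (u : J → ℝ) : Prop :=
  b.α₀ * u e + b.β₀ * D u e = ∑ i, b.α i * u (b.η i) + ∑ i, b.β i * D u (b.η i)

/-- `α₀ ≥ 0` and `α₀ + |β₀| > 0`. -/
def Nondegenerate (b : Condition e) : Prop := 0 ≤ b.α₀ ∧ 0 < b.α₀ + |b.β₀|

/-- The sign condition `± β₀ ≥ 0` at the end point `e = ± 1`. -/
def SignCondition (b : Condition e) : Prop := 0 ≤ (e : ℝ) * b.β₀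

/-- `(∑ |α i| / α₀)² + (∑ |β i| / β₀)² < 1`, where a vanishing denominator forces the numerator
to vanish and the fraction is then omitted (in Lean it has the value `0`). -/
def Small (b : Condition e) : Prop :=
  (b.α₀ = 0 → ∑ i, |b.α i| = 0) ∧ (b.β₀ = 0 → ∑ i, |b.β i| = 0) ∧
    ((∑ i, |b.α i|) / b.α₀) ^ 2 + ((∑ i, |b.β i|) / b.β₀) ^ 2 < 1

end Condition

theorem ext_add (u v : J → ℝ) : ext (u + v) = ext u + ext v := rfl

theorem ext_smul (c : ℝ) (u : J → ℝ) : ext (c • u) = c • ext u := rfl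

theorem D_add {u v : J → ℝ} (hu : IsC 1 u) (hv : IsC 1 v) : D (u + v) = D u + D v := by
  funext x
  simp only [D, ext_add, Pi.add_apply]
  exact derivWithin_add (hu.differentiableOn (by norm_num) x x.2)
    (hv.differentiableOn (by norm_num) x x.2)

theorem D_smul (c : ℝ) {u : J → ℝ} (hu : IsC 1 u) : D (c • u) = c • D u := by
  funext x
  simp only [D, ext_smul, Pi.smul_apply]
  exact derivWithin_const_smul c (hu.differentiableOn (by norm_num) x x.2)

theorem D_zero : D 0 = 0 := by
  have h : IsC 1 0 := contDiffOn_const (c := (0 : ℝ))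
  simpa using D_smul 0 h

theorem IsC.one {u : J → ℝ} (hu : IsC 2 u) : IsC 1 u :=
  ContDiffOn.of_le hu (by norm_num)

theorem IsC.D {u : J → ℝ} (hu : IsC 2 u) : IsC 1 (D u) := by
  have h : ContDiffOn ℝ 1 (derivWithin (ext u) (Icc (-1) 1)) (Icc (-1) 1) :=
    ContDiffOn.derivWithin hu (uniqueDiffOn_Icc (by norm_num)) (by norm_num)
  refine h.congr fun x hx => ?_
  exact IccExtend_of_mem (by norm_num) _ hx

/-- The space `X` of functions `u ∈ C²[-1,1]` satisfying both boundary conditions. -/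
noncomputable def X (bL : Condition leftEnd) (bR : Condition rightEnd) :
    Submodule ℝ (J → ℝ) where
  carrier := {u | IsC 2 u ∧ bL.Holds u ∧ bR.Holds u}
  zero_mem' := by
    refine ⟨contDiffOn_const (c := (0 : ℝ)), ?_, ?_⟩ <;> simp [Condition.Holds, D_zero]
  add_mem' := by
    rintro u v ⟨hu, huL, huR⟩ ⟨hv, hvL, hvR⟩
    refine ⟨ContDiffOn.add hu hv, ?_, ?_⟩
    · simp only [Condition.Holds, D_add hu.one hv.one, Pi.add_apply, mul_add,
        Finset.sum_add_distrib] at huL hvL ⊢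
      linarith
    · simp only [Condition.Holds, D_add hu.one hv.one, Pi.add_apply, mul_add,
        Finset.sum_add_distrib] at huR hvR ⊢
      linarith
  smul_mem' := by
    rintro c u ⟨hu, huL, huR⟩
    refine ⟨ContDiffOn.const_smul c hu, ?_, ?_⟩
    · simp only [Condition.Holds, D_smul c hu.one, Pi.smul_apply, smul_eq_mul,
        mul_left_comm _ c, ← Finset.mul_sum, ← mul_add] at huL ⊢
      rw [huL]
    · simp only [Condition.Holds, D_smul c hu.one, Pi.smul_apply, smul_eq_mul,
        mul_left_comm _ c, ← Finset.mul_sum, ← mul_add] at huR ⊢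
      rw [huR]

/-- The space of all `u ∈ X` with `-u'' = lam u` on `(-1,1)`. -/
noncomputable def eigenspace (bL : Condition leftEnd) (bR : Condition rightEnd) (lam : ℝ) :
    Submodule ℝ (J → ℝ) where
  carrier := {u | u ∈ X bL bR ∧ ∀ x : J, (x : ℝ) ∈ Ioo (-1 : ℝ) 1 → -D (D u) x = lam * u x}
  zero_mem' := ⟨Submodule.zero_mem _, by simp [D_zero]⟩
  add_mem' := by
    rintro u v ⟨hu, hu'⟩ ⟨hv, hv'⟩
    refine ⟨Submodule.add_mem _ hu hv, fun x hx => ?_⟩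
    rw [D_add hu.1.one hv.1.one, D_add hu.1.D hv.1.D]
    simp only [Pi.add_apply]
    linarith [hu' x hx, hv' x hx]
  smul_mem' := by
    rintro c u ⟨hu, hu'⟩
    refine ⟨Submodule.smul_mem _ c hu, fun x hx => ?_⟩
    rw [D_smul c hu.1.one, D_smul c hu.1.D]
    simp only [Pi.smul_apply, smul_eq_mul]
    linear_combination c * hu' x hx

/-- An eigenfunction for `lam` is a nonzero element of the eigenspace. -/
def IsEigenfunction (bL : Condition leftEnd) (bR : Condition rightEnd) (lam : ℝ)
    (u : J → ℝ) : Prop :=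
  u ∈ eigenspace bL bR lam ∧ u ≠ 0

/-- The spectrum: the set of all (real) eigenvalues. -/
def spectrum (bL : Condition leftEnd) (bR : Condition rightEnd) : Set ℝ :=
  {lam | ∃ u, IsEigenfunction bL bR lam u}

/-- The set of `u ∈ C¹[-1,1]` having only simple zeros. -/
def Cs : Set (J → ℝ) := {u | IsC 1 u ∧ ∀ x, 0 < |u x| + |D u x|}

/-- `ω` is the modified Prüfer angle of `(lam, u)`: the continuous determination of the angle from
`(1,0)` to the vector `(u', lam^{1/2} u)`, normalised by `ω(-1) ∈ (-π, π]`.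
For `lam > 0` and `u ∈ Cs` there is exactly one such function. -/
def IsPruferAngle (lam : ℝ) (u : J → ℝ) (ω : J → ℝ) : Prop :=
  Continuous ω ∧ ω leftEnd ∈ Ioc (-Real.pi) Real.pi ∧
    ∀ x, D u x = √(D u x ^ 2 + lam * u x ^ 2) * Real.cos (ω x) ∧
      √lam * u x = √(D u x ^ 2 + lam * u x ^ 2) * Real.sin (ω x)

/-- The angle `-arctan (lam^{1/2} β₀ / α₀)` at the end point `-1`, taken in `[0, π/2]`. -/
noncomputable def angleLeft (bL : Condition leftEnd) (lam : ℝ) : ℝ :=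
  if bL.α₀ = 0 then Real.pi / 2 else -Real.arctan (√lam * bL.β₀ / bL.α₀)

/-- The angle `-arctan (lam^{1/2} β₀ / α₀)` at the end point `1`, taken in `[π/2, π]`. -/
noncomputable def angleRight (bR : Condition rightEnd) (lam : ℝ) : ℝ :=
  if bR.α₀ = 0 then Real.pi / 2 else Real.pi - Real.arctan (√lam * bR.β₀ / bR.α₀)

/-- The set `P_k^+` of pairs `(lam, u)`, with `lam > 0`, of oscillation count `k`. -/
def PPlus (bL : Condition leftEnd) (bR : Condition rightEnd) (k : ℕ) : Set (ℝ × (J → ℝ)) :=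
  {p | 0 < p.1 ∧ p.2 ∈ Cs ∧ ∃ ω : J → ℝ, IsPruferAngle p.1 p.2 ω ∧
    |ω leftEnd - angleLeft bL p.1| < Real.pi / 2 ∧
    |ω rightEnd - angleRight bR p.1 - k * Real.pi| < Real.pi / 2}

end MultiPoint

/-! For `lam = s ^ 2 > 0` every solution is a multiple of `sin (s x + θ)`, so each boundary
condition becomes an equation for the phase `θ`. For fixed `s` its defect is a sinusoid in `θ`. By
Cauchy–Schwarz, the smallness condition keeps the interior terms below the amplitude of the end
point terms, so the sinusoid is not identically zero. Its zeros are therefore `shift s + n π`, with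
`shift s` the one within `π / 2` of the phase `s + phase s` of the problem without interior points.

The core is that `shift` increases strictly with `s` (`strictMonoOn_shift`). By implicit
differentiation this needs `defectθ > 0` and `defectS < 0` at the shift; the second is the delicate
sign (`defectS_neg`, resting on `nonneg_of_balance`).

Reflecting the right condition to `-1`, both conditions are compatible exactly when `shiftDiff s`,
the sum of the two shifts minus `π`, is an integer multiple of `π`. This function is continuous,
strictly increasing, unbounded, and has a limit `l ∈ {-π, -π/2, 0}` at `0+`, with `l = 0` only in
the Neumann-type case. So it takes each value `k π > l` exactly once, which leaves `k ≥ 0` (and `k ≥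
1` if `l = 0`). The Prüfer angle of the wave is `s x + θ` itself, so this `k` is the oscillation
count.

For `lam ≤ 0` a maximum principle (`max_at_end`, `eq_zero_of_max`) leaves only constants, with `lam
= 0` in the Neumann-type case; they fill the slot `k = 0` that is missing when `l = 0`. -/

section

/-! ### One boundary condition at fixed frequency: existence and uniqueness of the phase modulo `π`.
-/

open Real Finset

/-- The data of a multi-point condition at the left end point `-1`, with `b` standing for
minus the coefficient of the derivative at `-1`. -/
structure MultiPointData where
  m : ℕ
  a : ℝ
  b : ℝ
  α : Fin m → ℝ
  β : Fin m → ℝ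
  η : Fin m → ℝ

namespace MultiPointData

structure Admissible (d : MultiPointData) : Prop where
  a_nonneg : 0 ≤ d.a
  b_nonneg : 0 ≤ d.b
  pos : 0 < d.a + d.b
  sum_α : d.a = 0 → ∑ i, |d.α i| = 0
  sum_β : d.b = 0 → ∑ i, |d.β i| = 0
  small : ((∑ i, |d.α i|) / d.a) ^ 2 + ((∑ i, |d.β i|) / d.b) ^ 2 < 1
  abs_η : ∀ i, |d.η i| ≤ 1

variable (d : MultiPointData)

/-- The defect of `sin (s x + θ)` in the boundary condition. -/
noncomputable def defect (s θ : ℝ) : ℝ :=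
  d.a * sin (θ - s) - s * d.b * cos (θ - s)
    - ∑ i, (d.α i * sin (θ + s * d.η i) + s * d.β i * cos (θ + s * d.η i))

/-- The derivative of `defect` in `θ`. -/
noncomputable def defectθ (s θ : ℝ) : ℝ :=
  d.a * cos (θ - s) + s * d.b * sin (θ - s)
    - ∑ i, (d.α i * cos (θ + s * d.η i) - s * d.β i * sin (θ + s * d.η i))

/-- For fixed `s` the defect is a sinusoid in the phase, hence determined by its value and
derivative at a single point. -/
theorem defect_add (s θ τ : ℝ) :
    d.defect s (θ + τ) = d.defect s θ * cos τ + d.defectθ s θ * sin τ := by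
  have h : ∀ i, d.α i * sin (θ + τ + s * d.η i) + s * d.β i * cos (θ + τ + s * d.η i)
      = (d.α i * sin (θ + s * d.η i) + s * d.β i * cos (θ + s * d.η i)) * cos τ
        + (d.α i * cos (θ + s * d.η i) - s * d.β i * sin (θ + s * d.η i)) * sin τ := by
    intro i
    rw [show θ + τ + s * d.η i = (θ + s * d.η i) + τ by ring, sin_add _ τ, cos_add _ τ]
    ring
  simp only [defect, defectθ, h, sum_add_distrib (f := fun i => _ * cos τ), ← sum_mul]
  rw [show θ + τ - s = (θ - s) + τ by ring, sin_add, cos_add]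
  ring

theorem defectθ_add (s θ τ : ℝ) :
    d.defectθ s (θ + τ) = d.defectθ s θ * cos τ - d.defect s θ * sin τ := by
  have h : ∀ i, d.α i * cos (θ + τ + s * d.η i) - s * d.β i * sin (θ + τ + s * d.η i)
      = (d.α i * cos (θ + s * d.η i) - s * d.β i * sin (θ + s * d.η i)) * cos τ
        - (d.α i * sin (θ + s * d.η i) + s * d.β i * cos (θ + s * d.η i)) * sin τ := by
    intro i
    rw [show θ + τ + s * d.η i = (θ + s * d.η i) + τ by ring, sin_add _ τ, cos_add _ τ]
    ring
  simp only [defect, defectθ, h, sum_sub_distrib (f := fun i => _ * cos τ), ← sum_mul]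
  rw [show θ + τ - s = (θ - s) + τ by ring, sin_add, cos_add]
  ring

/-- The angle of the vector `(a, s b)`. -/
noncomputable def phase (s : ℝ) : ℝ := if d.a = 0 then π / 2 else arctan (s * d.b / d.a)

noncomputable def radius (s : ℝ) : ℝ := √(d.a ^ 2 + (s * d.b) ^ 2)

variable {d}

namespace Admissible

theorem phase_nonneg (hd : d.Admissible) {s : ℝ} (hs : 0 < s) : 0 ≤ d.phase s := by
  unfold phase
  split_ifs
  · positivity
  · exact arctan_nonneg.2 (div_nonneg (mul_nonneg hs.le hd.b_nonneg) hd.a_nonneg)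

theorem phase_le (s : ℝ) : d.phase s ≤ π / 2 := by
  unfold phase
  split_ifs
  · exact le_rfl
  · exact (arctan_lt_pi_div_two _).le

theorem radius_pos (hd : d.Admissible) {s : ℝ} (hs : 0 < s) : 0 < d.radius s := by
  refine sqrt_pos.2 ?_
  rcases hd.a_nonneg.eq_or_lt with h | h
  · have := hd.pos
    rw [← h, zero_add] at this
    positivity
  · positivity

theorem radius_sq (s : ℝ) : d.radius s ^ 2 = d.a ^ 2 + (s * d.b) ^ 2 :=
  sq_sqrt (by positivity)

theorem radius_mul_cos_phase (hd : d.Admissible) {s : ℝ} (hs : 0 < s) :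
    d.radius s * cos (d.phase s) = d.a := by
  unfold phase
  split_ifs with h
  · simp [h]
  · have ha : 0 < d.a := hd.a_nonneg.lt_of_ne' h
    rw [cos_arctan, radius, show d.a ^ 2 + (s * d.b) ^ 2 = d.a ^ 2 * (1 + (s * d.b / d.a) ^ 2) by
      field_simp, sqrt_mul (by positivity), sqrt_sq ha.le]
    have : √(1 + (s * d.b / d.a) ^ 2) ≠ 0 := (sqrt_pos.2 (by positivity)).ne'
    field_simp

theorem radius_mul_sin_phase (hd : d.Admissible) {s : ℝ} (hs : 0 < s) :
    d.radius s * sin (d.phase s) = s * d.b := by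
  unfold phase
  split_ifs with h
  · have : 0 ≤ s * d.b := mul_nonneg hs.le hd.b_nonneg
    simp [h, radius, sqrt_sq this]
  · have ha : 0 < d.a := hd.a_nonneg.lt_of_ne' h
    rw [sin_arctan, radius, show d.a ^ 2 + (s * d.b) ^ 2 = d.a ^ 2 * (1 + (s * d.b / d.a) ^ 2) by
      field_simp, sqrt_mul (by positivity), sqrt_sq ha.le]
    have : √(1 + (s * d.b / d.a) ^ 2) ≠ 0 := (sqrt_pos.2 (by positivity)).ne'
    field_simp

theorem sum_α_eq (hd : d.Admissible) : ∑ i, |d.α i| = (∑ i, |d.α i|) / d.a * d.a := by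
  by_cases h : d.a = 0
  · simp [h, hd.sum_α h]
  · field_simp

theorem sum_β_eq (hd : d.Admissible) : ∑ i, |d.β i| = (∑ i, |d.β i|) / d.b * d.b := by
  by_cases h : d.b = 0
  · simp [h, hd.sum_β h]
  · field_simp

/-- Cauchy–Schwarz for the vector of the two ratios in the smallness condition, of length less than
`1`, against `(a, s b)`. The bound thus holds at every frequency. -/
theorem sum_lt_radius (hd : d.Admissible) {s : ℝ} (hs : 0 < s) :
    ∑ i, |d.α i| + s * ∑ i, |d.β i| < d.radius s := by
  have hR := hd.radius_pos hs
  refine lt_of_pow_lt_pow_left₀ 2 hR.le ?_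
  rw [hd.sum_α_eq, hd.sum_β_eq]
  set p := (∑ i, |d.α i|) / d.a
  set q := (∑ i, |d.β i|) / d.b
  have hpq : p ^ 2 + q ^ 2 < 1 := hd.small
  have h1 : (p * d.a + s * (q * d.b)) ^ 2 ≤ (p ^ 2 + q ^ 2) * (d.a ^ 2 + (s * d.b) ^ 2) := by
    nlinarith [sq_nonneg (p * (s * d.b) - q * d.a)]
  have h2 := radius_sq (d := d) s
  nlinarith [pow_pos hR 2]

/-- Both defects of the zero-order part are controlled by the radius. -/
theorem sq_add_sq_lt (hd : d.Admissible) {s : ℝ} (hs : 0 < s) (x y : Fin d.m → ℝ)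
    (x' y' : Fin d.m → ℝ) (h : ∀ i, x i ^ 2 + y i ^ 2 ≤ 1) (h' : ∀ i, x' i ^ 2 + y' i ^ 2 ≤ 1) :
    (∑ i, (d.α i * x i + s * d.β i * x' i)) ^ 2 + (∑ i, (d.α i * y i + s * d.β i * y' i)) ^ 2
      < d.radius s ^ 2 := by
  set Q := ∑ i, (d.α i * x i + s * d.β i * x' i) with hQ
  set T := ∑ i, (d.α i * y i + s * d.β i * y' i) with hT
  have key : ∀ x y : ℝ, x ^ 2 + y ^ 2 ≤ 1 → |Q * x + T * y| ≤ √(Q ^ 2 + T ^ 2) := by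
    intro x y hxy
    refine abs_le_sqrt ?_
    have : (Q * x + T * y) ^ 2 ≤ (Q ^ 2 + T ^ 2) * (x ^ 2 + y ^ 2) := by
      nlinarith [sq_nonneg (Q * y - T * x)]
    nlinarith [sq_nonneg Q, sq_nonneg T]
  set r := √(Q ^ 2 + T ^ 2) with hr
  have hr0 : 0 ≤ r := sqrt_nonneg _
  have hr2 : r ^ 2 = Q ^ 2 + T ^ 2 := sq_sqrt (by positivity)
  -- Pairing `(Q, T)` with itself proves the triangle inequality in the plane: each summand is a
  -- coefficient times a vector of the unit disc.
  have e : Q ^ 2 + T ^ 2 = ∑ i, (d.α i * (Q * x i + T * y i) + s * d.β i * (Q * x' i + T * y' i)) := by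
    calc Q ^ 2 + T ^ 2 = Q * ∑ i, (d.α i * x i + s * d.β i * x' i)
          + T * ∑ i, (d.α i * y i + s * d.β i * y' i) := by rw [← hQ, ← hT]; ring
      _ = _ := by
        rw [mul_sum, mul_sum, ← sum_add_distrib]
        exact sum_congr rfl fun i _ => by ring
  have bound : Q ^ 2 + T ^ 2 ≤ (∑ i, |d.α i| + s * ∑ i, |d.β i|) * r := by
    rw [e, mul_sum, ← sum_add_distrib, sum_mul]
    refine sum_le_sum fun i _ => ?_
    have h1 : d.α i * (Q * x i + T * y i) ≤ |d.α i| * r := by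
      refine (le_abs_self _).trans ?_
      rw [abs_mul]
      exact mul_le_mul_of_nonneg_left (key _ _ (h i)) (abs_nonneg _)
    have h2 : d.β i * (Q * x' i + T * y' i) ≤ |d.β i| * r := by
      refine (le_abs_self _).trans ?_
      rw [abs_mul]
      exact mul_le_mul_of_nonneg_left (key _ _ (h' i)) (abs_nonneg _)
    nlinarith
  have hlt := hd.sum_lt_radius hs
  have hR := hd.radius_pos hs
  rw [← hr2] at bound ⊢
  have : r < d.radius s := by
    rcases hr0.eq_or_lt with h0 | h0
    · rw [← h0]; exact hR
    · nlinarith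
  exact pow_lt_pow_left₀ this hr0 two_ne_zero

/-- At this phase the end point terms contribute their full amplitude `radius s`, which dominates
the interior terms. -/
theorem defectθ_phase_pos (hd : d.Admissible) {s : ℝ} (hs : 0 < s) :
    0 < d.defectθ s (s + d.phase s) := by
  have hR := hd.radius_pos hs
  have h1 := hd.sq_add_sq_lt hs (fun i => cos (s + d.phase s + s * d.η i)) 0
    (fun i => - sin (s + d.phase s + s * d.η i)) 0
    (fun i => by simp [abs_cos_le_one]) (fun i => by simp [abs_sin_le_one])
  have h2 : ∑ i, (d.α i * cos (s + d.phase s + s * d.η i)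
      + s * d.β i * - sin (s + d.phase s + s * d.η i)) < d.radius s := by
    refine lt_of_pow_lt_pow_left₀ 2 hR.le ?_
    simpa using h1
  have hc := hd.radius_mul_cos_phase hs
  have hss := hd.radius_mul_sin_phase hs
  have h3 : d.a * cos (d.phase s) + s * d.b * sin (d.phase s) = d.radius s := by
    rw [← hc, ← hss]
    linear_combination d.radius s * sin_sq_add_cos_sq (d.phase s)
  simp only [defectθ, add_sub_cancel_left, h3, sub_pos]
  simpa only [mul_neg, ← sub_eq_add_neg] using h2

end Admissible

variable (d) in
/-- The phase shift `θ` for which `sin (s x + θ)` satisfies the boundary condition. -/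
noncomputable def shift (s : ℝ) : ℝ :=
  s + d.phase s - arctan (d.defect s (s + d.phase s) / d.defectθ s (s + d.phase s))

/-- The principal value of `arctan` selects one branch for all `s`. The bound `π / 2` is the one in
the definition of `PPlus`, so it settles the oscillation count later. -/
theorem abs_shift_sub_lt (s : ℝ) : |d.shift s - s - d.phase s| < π / 2 := by
  rw [shift, show ∀ x y z : ℝ, x + y - z - x - y = -z by intros; ring, abs_neg, abs_lt]
  exact ⟨neg_pi_div_two_lt_arctan _, arctan_lt_pi_div_two _⟩

namespace Admissible

theorem defect_shift (hd : d.Admissible) {s : ℝ} (hs : 0 < s) : d.defect s (d.shift s) = 0 := by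
  have h := hd.defectθ_phase_pos hs
  rw [shift, sub_eq_add_neg, defect_add, cos_neg, sin_neg, ← tan_mul_cos (cos_arctan_pos _).ne',
    tan_arctan]
  field_simp
  ring

theorem defectθ_shift_pos (hd : d.Admissible) {s : ℝ} (hs : 0 < s) :
    0 < d.defectθ s (d.shift s) := by
  have h := hd.defectθ_phase_pos hs
  have hc := cos_arctan_pos (d.defect s (s + d.phase s) / d.defectθ s (s + d.phase s))
  rw [shift, sub_eq_add_neg, defectθ_add, cos_neg, sin_neg, ← tan_mul_cos hc.ne', tan_arctan]
  have : ∀ x y c : ℝ, 0 < x → 0 < c → 0 < x * c - y * -(y / x * c) := by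
    intro x y c hx hc'
    rw [show x * c - y * -(y / x * c) = c * (x ^ 2 + y ^ 2) / x by field_simp; ring]
    positivity
  exact this _ _ _ h hc

theorem defect_eq_zero_iff (hd : d.Admissible) {s : ℝ} (hs : 0 < s) (θ : ℝ) :
    d.defect s θ = 0 ↔ ∃ n : ℤ, θ = d.shift s + n * π := by
  have h := d.defect_add s (d.shift s) (θ - d.shift s)
  rw [add_sub_cancel, hd.defect_shift hs, zero_mul, zero_add] at h
  rw [h, mul_eq_zero, or_iff_right (hd.defectθ_shift_pos hs).ne', sin_eq_zero_iff]
  exact exists_congr fun n => ⟨fun e => by linarith, fun e => by linarith⟩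

end Admissible
end MultiPointData

end

/-! ### Dependence of the phase shift on the frequency: monotonicity and the limit at zero. -/

section

open Real Finset

namespace MultiPointData

variable (d : MultiPointData)

/-- The derivative of `defect` in `s`. -/
noncomputable def defectS (s θ : ℝ) : ℝ :=
  -(d.a * cos (θ - s)) - d.b * cos (θ - s) - s * d.b * sin (θ - s)
    - ∑ i, (d.α i * (d.η i * cos (θ + s * d.η i))
      + (d.β i * cos (θ + s * d.η i) - s * d.β i * (d.η i * sin (θ + s * d.η i))))

theorem hasDerivAt_defect {Θ : ℝ → ℝ} {Θ' s : ℝ} (h : HasDerivAt Θ Θ' s) :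
    HasDerivAt (fun s => d.defect s (Θ s)) (d.defectθ s (Θ s) * Θ' + d.defectS s (Θ s)) s := by
  have h1 : HasDerivAt (fun s => Θ s - s) (Θ' - 1) s := h.sub (hasDerivAt_id s)
  have h2 : ∀ i, HasDerivAt (fun s => Θ s + s * d.η i) (Θ' + 1 * d.η i) s := fun i =>
    h.add ((hasDerivAt_id s).mul_const _)
  have h3 := (h1.sin.const_mul d.a).sub (((hasDerivAt_id s).mul_const d.b).mul h1.cos)
  have h4 : ∀ i ∈ univ, HasDerivAt (fun s => d.α i * sin (Θ s + s * d.η i)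
      + s * d.β i * cos (Θ s + s * d.η i)) _ s := fun i _ =>
    ((h2 i).sin.const_mul (d.α i)).add (((hasDerivAt_id s).mul_const (d.β i)).mul (h2 i).cos)
  refine HasDerivAt.congr_deriv (h3.sub (HasDerivAt.fun_sum h4)) ?_
  rw [defectθ, defectS]
  rw [sub_mul, sum_mul, add_sub_assoc', sub_add_eq_add_sub,
    sub_sub _ (∑ i, _) (∑ i, _), ← sum_add_distrib]
  congr 1
  · simp only [id]; ring
  · exact sum_congr rfl fun i _ => by simp only [id]; ring

namespace Admissible
variable {d}

/-- The sign of `b u'(-1) + ∑ β i u'(η i)` for `u = sin (s x + θ)`, in algebraic form. -/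
theorem nonneg_of_balance {a b A B c sn X Y s : ℝ} (hs : 0 < s) (ha : 0 ≤ a) (hb : 0 ≤ b)
    (hA : a = 0 → A = 0) (hB : b = 0 → B = 0)
    (hsmall : (A / a) ^ 2 + (B / b) ^ 2 < 1) (hX : |X| ≤ A) (hY : |Y| ≤ B)
    (hcs : sn ^ 2 + c ^ 2 = 1) (hP : 0 < a * c + s * b * sn)
    (heq : a * sn - s * b * c = X + s * Y) : 0 ≤ b * c + Y := by
  -- If the claim fails, the balance equation forces `c < q` and `sn < p` for the two ratios `p`,
  -- `q`, whose squares sum to less than `1`. Each sign pattern of `(sn, c)` on the unit circle is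
  -- then impossible.
  by_contra! hE
  have hX' := abs_le.1 hX
  have hY' := abs_le.1 hY
  have h1 : b * c < B := by linarith [hY'.1]
  have h2 : a * sn < A := by nlinarith
  have ha' : 0 < a := by
    refine ha.lt_of_ne' fun h => ?_
    rw [hA h, h] at h2
    simp at h2
  have hb' : 0 < b := by
    refine hb.lt_of_ne' fun h => ?_
    rw [hB h, h] at h1
    simp at h1
  obtain ⟨p, hp⟩ : ∃ p, p = A / a := ⟨_, rfl⟩
  obtain ⟨q, hq⟩ : ∃ q, q = B / b := ⟨_, rfl⟩
  rw [← hp, ← hq] at hsmall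
  have hpA : A = a * p := by rw [hp]; field_simp
  have hqB : B = b * q := by rw [hq]; field_simp
  have hcq : c < q := by
    rw [hqB] at h1
    exact lt_of_mul_lt_mul_left h1 hb
  have hsp : sn < p := by
    rw [hpA] at h2
    exact lt_of_mul_lt_mul_left h2 ha
  have hp0 : 0 ≤ p := by rw [hp]; exact div_nonneg ((abs_nonneg _).trans hX) ha
  have hq0 : 0 ≤ q := by rw [hq]; exact div_nonneg ((abs_nonneg _).trans hY) hb
  have hsb : 0 < s * b := by positivity
  have hbound : |a * sn - s * b * c| ≤ a * p + s * b * q := by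
    rw [heq, abs_le]
    constructor <;> nlinarith
  have hbd := abs_le.1 hbound
  generalize s * b = t at *
  rcases le_or_gt 0 c with hc | hc <;> rcases le_or_gt 0 sn with hn | hn
  · have h3 : c ^ 2 ≤ q ^ 2 := pow_le_pow_left₀ hc hcq.le 2
    have h4 : sn ^ 2 ≤ p ^ 2 := pow_le_pow_left₀ hn hsp.le 2
    linarith
  · -- `sn < 0 ≤ c`
    have hpn : p < -sn := by
      have h3 : c ^ 2 ≤ q ^ 2 := pow_le_pow_left₀ hc hcq.le 2
      exact lt_of_pow_lt_pow_left₀ 2 (by linarith) (by rw [neg_sq]; linarith)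
    -- Combining the balance bound with `hP` eliminates `a` and leaves `t (1 - (c q - sn p)) ≤ 0`,
    -- although the inner product of the unit vector `(c, -sn)` with `(q, p)` is below `1`. The case
    -- `c < 0 ≤ sn` is symmetric.
    have h3 : a * (-sn - p) ≤ t * (q - c) := by linarith [hbd.1]
    have h4 : t * (-sn) * (-sn - p) ≤ a * c * (-sn - p) :=
      mul_le_mul_of_nonneg_right (by linarith) (by linarith)
    have h5 : a * (-sn - p) * c ≤ t * (q - c) * c := mul_le_mul_of_nonneg_right h3 hc
    have h6 : t * (sn ^ 2 + c ^ 2 - (c * q + -sn * p)) ≤ 0 := by linarith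
    have h7 : c * q + -sn * p < 1 := by linarith [sq_nonneg (c - q), sq_nonneg (-sn - p)]
    exact h6.not_gt (mul_pos hsb (by linarith))
  · have hqc : q < -c := by
      have h3 : sn ^ 2 ≤ p ^ 2 := pow_le_pow_left₀ hn hsp.le 2
      exact lt_of_pow_lt_pow_left₀ 2 (by linarith) (by rw [neg_sq]; linarith)
    have h3 : t * (-c - q) ≤ a * (p - sn) := by linarith [hbd.2]
    have h4 : a * (-c) * (-c - q) ≤ t * sn * (-c - q) :=
      mul_le_mul_of_nonneg_right (by linarith) (by linarith)
    have h5 : t * (-c - q) * sn ≤ a * (p - sn) * sn := mul_le_mul_of_nonneg_right h3 hn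
    have h6 : a * (sn ^ 2 + c ^ 2 - (-c * q + sn * p)) ≤ 0 := by linarith
    have h7 : -c * q + sn * p < 1 := by linarith [sq_nonneg (-c - q), sq_nonneg (sn - p)]
    exact h6.not_gt (mul_pos ha' (by linarith))
  · have h3 := mul_neg_of_pos_of_neg ha' hc
    have h4 := mul_neg_of_pos_of_neg hsb hn
    linarith

/-- The derivative splits as `-(P + Q + E)`: `P` comes from moving the end point, `Q` from moving
the interior points, and `E` from the factor `s` in front of the derivatives. At a zero of the
defect, `P² + T² = radius²` while `Q² + T² < radius²`, so `|Q| < P`; `E ≥ 0` is `nonneg_of_balance`.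
-/
theorem defectS_neg (hd : d.Admissible) {s : ℝ} (hs : 0 < s) {θ : ℝ} (h0 : d.defect s θ = 0)
    (hθ : |θ - s - d.phase s| < π / 2) : d.defectS s θ < 0 := by
  have hR := hd.radius_pos hs
  have hc := hd.radius_mul_cos_phase hs
  have hsn := hd.radius_mul_sin_phase hs
  have hP : 0 < d.a * cos (θ - s) + s * d.b * sin (θ - s) := by
    have := mul_pos hR (cos_pos_of_mem_Ioo (abs_lt.1 hθ))
    rw [cos_sub] at this
    rw [← hc, ← hsn]
    linarith
  have hT : d.a * sin (θ - s) - s * d.b * cos (θ - s)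
      = ∑ i, (d.α i * sin (θ + s * d.η i) + s * d.β i * cos (θ + s * d.η i)) :=
    sub_eq_zero.1 h0
  have hη : ∀ i, d.η i ^ 2 ≤ 1 := fun i => (sq_le_one_iff_abs_le_one _).2 (hd.abs_η i)
  -- `|η i| ≤ 1` puts these vectors in the unit disc; their second components reproduce the interior
  -- part `T` of the condition.
  have hQ := hd.sq_add_sq_lt hs (fun i => d.η i * cos (θ + s * d.η i))
    (fun i => sin (θ + s * d.η i)) (fun i => -(d.η i * sin (θ + s * d.η i)))
    (fun i => cos (θ + s * d.η i))
    (fun i => by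
      have := sin_sq_add_cos_sq (θ + s * d.η i)
      nlinarith [mul_le_mul_of_nonneg_right (hη i) (sq_nonneg (cos (θ + s * d.η i)))])
    (fun i => by
      have := sin_sq_add_cos_sq (θ + s * d.η i)
      nlinarith [mul_le_mul_of_nonneg_right (hη i) (sq_nonneg (sin (θ + s * d.η i)))])
  rw [← hT, radius_sq] at hQ
  set Q := ∑ i, (d.α i * (d.η i * cos (θ + s * d.η i))
    + s * d.β i * -(d.η i * sin (θ + s * d.η i))) with hQdef
  have hQP : |Q| < d.a * cos (θ - s) + s * d.b * sin (θ - s) := by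
    refine abs_lt_of_sq_lt_sq ?_ hP.le
    have := sin_sq_add_cos_sq (θ - s)
    nlinarith
  have hE : 0 ≤ d.b * cos (θ - s) + ∑ i, d.β i * cos (θ + s * d.η i) := by
    refine nonneg_of_balance (X := ∑ i, d.α i * sin (θ + s * d.η i)) hs hd.a_nonneg
      hd.b_nonneg hd.sum_α hd.sum_β hd.small ?_ ?_ (sin_sq_add_cos_sq (θ - s)) hP ?_
    · refine (abs_sum_le_sum_abs _ _).trans (sum_le_sum fun i _ => ?_)
      rw [abs_mul]
      exact mul_le_of_le_one_right (abs_nonneg _) (abs_sin_le_one _)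
    · refine (abs_sum_le_sum_abs _ _).trans (sum_le_sum fun i _ => ?_)
      rw [abs_mul]
      exact mul_le_of_le_one_right (abs_nonneg _) (abs_cos_le_one _)
    · rw [hT, mul_sum, ← sum_add_distrib]
      exact sum_congr rfl fun i _ => by ring
  have e : ∑ i, (d.α i * (d.η i * cos (θ + s * d.η i))
      + (d.β i * cos (θ + s * d.η i) - s * d.β i * (d.η i * sin (θ + s * d.η i))))
      = Q + ∑ i, d.β i * cos (θ + s * d.η i) := by
    rw [hQdef, ← sum_add_distrib]
    exact sum_congr rfl fun i _ => by ring
  rw [defectS, e]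
  linarith [(abs_lt.1 hQP).1]

theorem differentiableAt_shift (hd : d.Admissible) {s : ℝ} (hs : 0 < s) :
    DifferentiableAt ℝ d.shift s := by
  have h1 : DifferentiableAt ℝ d.phase s := by
    unfold phase
    split_ifs
    · fun_prop
    · exact (by fun_prop : DifferentiableAt ℝ (fun s => s * d.b / d.a) s).arctan
  have h2 : DifferentiableAt ℝ (fun s => d.defect s (s + d.phase s)) s := by
    unfold defect; fun_prop
  have h3 : DifferentiableAt ℝ (fun s => d.defectθ s (s + d.phase s)) s := by
    unfold defectθ; fun_prop
  have h4 := hd.defectθ_phase_pos hs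
  exact (differentiableAt_id.add h1).sub (h2.div h3 h4.ne').arctan

theorem continuousOn_shift (hd : d.Admissible) : ContinuousOn d.shift (Set.Ioi 0) :=
  fun _ hs => (hd.differentiableAt_shift hs).continuousAt.continuousWithinAt

/-- Differentiating `defect s (shift s) = 0` gives `defectθ * shift' = -defectS > 0`. -/
theorem strictMonoOn_shift (hd : d.Admissible) : StrictMonoOn d.shift (Set.Ioi 0) := by
  refine strictMonoOn_of_deriv_pos (convex_Ioi 0) hd.continuousOn_shift fun s hs => ?_
  rw [interior_Ioi] at hs
  have h1 := d.hasDerivAt_defect (hd.differentiableAt_shift hs).hasDerivAt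
  have h2 : HasDerivAt (fun s => d.defect s (d.shift s)) 0 s := by
    refine (hasDerivAt_const s (0 : ℝ)).congr_of_eventuallyEq ?_
    filter_upwards [Ioi_mem_nhds hs] with t ht using hd.defect_shift ht
  have h3 := h1.unique h2
  have h4 := hd.defectS_neg hs (hd.defect_shift hs) (abs_shift_sub_lt s)
  have h5 := hd.defectθ_shift_pos hs
  by_contra! h
  nlinarith

-- If `a ≠ 0`, the formula for `shift` is continuous at `0` with value `0`. If `a = 0`, all `α i`
-- vanish and a common factor `s` cancels from the quotient inside `arctan`.
open Filter Topology in
theorem tendsto_shift (hd : d.Admissible) :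
    Tendsto d.shift (𝓝[>] 0) (𝓝 (if d.a = 0 then π / 2 else 0)) := by
  have hpos : ∀ᶠ s : ℝ in 𝓝[>] 0, 0 < s := self_mem_nhdsWithin
  split_ifs with h
  · have hα : ∀ i, d.α i = 0 := fun i => by
      have := (sum_eq_zero_iff_of_nonneg fun i _ => abs_nonneg (d.α i)).1 (hd.sum_α h) i (mem_univ i)
      exact abs_eq_zero.1 this
    have hb : 0 < d.b := by simpa [h] using hd.pos
    have hB : ∑ i, |d.β i| < d.b := by
      have := hd.sum_lt_radius one_pos
      simpa [hα, radius, h, sqrt_sq hb.le] using this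
    have hB' : 0 < d.b + ∑ i, d.β i := by
      have := neg_abs_le (∑ i, d.β i)
      have := abs_sum_le_sum_abs d.β univ
      linarith
    -- The expression for `shift` after cancelling `s`; it stays continuous at `0`, where the
    -- original quotient degenerates to `0 / 0`.
    let g : ℝ → ℝ := fun s => s + π / 2 - arctan ((∑ i, d.β i * sin (s + s * d.η i))
      / (d.b + ∑ i, d.β i * cos (s + s * d.η i)))
    have hg : ContinuousAt g 0 := by
      refine (by fun_prop : ContinuousAt (fun s : ℝ => s + π / 2) 0).sub
        (continuous_arctan.continuousAt.comp (ContinuousAt.div ?_ ?_ ?_))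
      · fun_prop
      · fun_prop
      · simpa using hB'.ne'
    have hg0 : g 0 = π / 2 := by simp [g]
    rw [← hg0]
    refine (hg.tendsto.mono_left nhdsWithin_le_nhds).congr' ?_
    filter_upwards [hpos] with s hs
    have e1 : d.defect s (s + d.phase s) = s * ∑ i, d.β i * sin (s + s * d.η i) := by
      simp only [defect, phase, h, hα, if_true, mul_sum, add_sub_cancel_left, cos_pi_div_two]
      simp only [add_right_comm s (π / 2), cos_add_pi_div_two, zero_mul, mul_zero, zero_add,
        sub_zero, zero_sub, ← sum_neg_distrib]
      exact sum_congr rfl fun i _ => by ring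
    have e2 : d.defectθ s (s + d.phase s) = s * (d.b + ∑ i, d.β i * cos (s + s * d.η i)) := by
      simp only [defectθ, phase, h, hα, if_true, mul_add, mul_sum, add_sub_cancel_left,
        sin_pi_div_two]
      simp only [add_right_comm s (π / 2), sin_add_pi_div_two, zero_mul, zero_add, mul_one,
        zero_sub, sum_neg_distrib, sub_neg_eq_add, mul_assoc]
    rw [shift, e1, e2, mul_div_mul_left _ _ hs.ne']
    simp [g, phase, h]
  · have ha : 0 < d.a := hd.a_nonneg.lt_of_ne' h
    have hA : ∑ i, d.α i < d.a := by
      refine ((le_abs_self _).trans (abs_sum_le_sum_abs d.α univ)).trans_lt ?_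
      have h1 : (∑ i, |d.α i|) / d.a < 1 := by
        have := hd.small
        have h2 := sq_nonneg ((∑ i, |d.β i|) / d.b)
        nlinarith
      rwa [div_lt_one ha] at h1
    have hp : d.phase = fun s => arctan (s * d.b / d.a) := by
      funext s; simp [phase, h]
    have hg : ContinuousAt d.shift 0 := by
      have h1 : Continuous d.phase := by rw [hp]; fun_prop
      refine (by fun_prop : ContinuousAt (fun s : ℝ => s + d.phase s) 0).sub
        (continuous_arctan.continuousAt.comp (ContinuousAt.div ?_ ?_ ?_))
      · unfold defect; fun_prop
      · unfold defectθ; fun_prop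
      · simp [hp, defectθ]
        linarith
    have hg0 : d.shift 0 = 0 := by simp [shift, hp, defect]
    have := hg.tendsto.mono_left (nhdsWithin_le_nhds (s := Set.Ioi 0))
    rwa [hg0] at this

end Admissible
end MultiPointData

end

/-! ### Calculus on the closed interval. -/

section

open Real Set

namespace MultiPoint

theorem ext_coe (u : J → ℝ) (x : J) : ext u x = u x := IccExtend_val _ _ _

theorem hasDerivWithinAt_ext {u : J → ℝ} (hu : IsC 1 u) (x : J) :
    HasDerivWithinAt (ext u) (D u x) (Icc (-1) 1) x :=
  (hu.differentiableOn (by norm_num) x x.2).hasDerivWithinAt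

theorem D_eq_of_hasDerivWithinAt {u : J → ℝ} {x : J} {c : ℝ}
    (h : HasDerivWithinAt (ext u) c (Icc (-1) 1) x) : D u x = c :=
  h.derivWithin (uniqueDiffOn_Icc (by norm_num) x x.2)

/-- The equation is assumed only in the open interval; continuity of `u''` carries it to the end
points. -/
theorem D_D_eq {bL : Condition leftEnd} {bR : Condition rightEnd} {lam : ℝ} {u : J → ℝ}
    (hu : u ∈ eigenspace bL bR lam) (x : J) : D (D u) x = -(lam * u x) := by
  have h1 : IsC 1 (D u) := hu.1.1.D
  have h2 : EqOn (derivWithin (ext (D u)) (Icc (-1) 1)) (fun x => -(lam * ext u x))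
      (Icc (-1 : ℝ) 1) := by
    refine EqOn.of_subset_closure (s := Ioo (-1 : ℝ) 1) (fun y hy => ?_)
      (h1.continuousOn_derivWithin (uniqueDiffOn_Icc (by norm_num)) (by norm_num))
      (hu.1.1.continuousOn.const_smul lam).neg Ioo_subset_Icc_self ?_
    · have := hu.2 ⟨y, Ioo_subset_Icc_self hy⟩ hy
      have e := ext_coe u ⟨y, Ioo_subset_Icc_self hy⟩
      simp only at e ⊢
      rw [e, ← this, neg_neg]
      rfl
    · rw [closure_Ioo (by norm_num)]
  exact (h2 x.2).trans (by simp only [ext_coe])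

theorem eq_of_hasDerivWithinAt_zero {f : ℝ → ℝ}
    (h : ∀ x : J, HasDerivWithinAt f 0 (Icc (-1) 1) x) (x y : J) : f x = f y := by
  have key := constant_of_derivWithin_zero (f := f) (a := -1) (b := 1)
    (fun x hx => (h ⟨x, hx⟩).differentiableWithinAt)
    (fun x hx => (h ⟨x, Ico_subset_Icc_self hx⟩).derivWithin
      (uniqueDiffOn_Icc (by norm_num) x (Ico_subset_Icc_self hx)))
  rw [key x x.2, key y y.2]

/-! ### Sine waves as the general solution for positive `lam`. -/

section Wave

/-- The function `sin (s x + θ)` on `[-1,1]`. -/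
noncomputable def wave (s θ : ℝ) : J → ℝ := fun x => sin (s * x + θ)

theorem ext_eqOn {u : J → ℝ} {f : ℝ → ℝ} (h : ∀ x : J, u x = f x) :
    EqOn (ext u) f (Icc (-1) 1) := fun x hx => (ext_coe u ⟨x, hx⟩).trans (h ⟨x, hx⟩)

theorem isC_wave (n : ℕ) (s θ : ℝ) : IsC n (wave s θ) :=
  ContDiffOn.congr (f := fun x : ℝ => sin (s * x + θ)) (by fun_prop) (ext_eqOn fun _ => rfl)

theorem D_wave (s θ : ℝ) (x : J) : D (wave s θ) x = s * cos (s * x + θ) := by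
  refine D_eq_of_hasDerivWithinAt ?_
  have h : HasDerivAt (fun x : ℝ => sin (s * x + θ)) (s * cos (s * x + θ)) x := by
    have := (((hasDerivAt_id (x : ℝ)).const_mul s).add_const θ).sin
    exact this.congr_deriv (by simp only [id]; ring)
  exact h.hasDerivWithinAt.congr_of_mem (ext_eqOn fun _ => rfl) x.2

theorem D_D_wave (s θ : ℝ) (x : J) : D (D (wave s θ)) x = -(s ^ 2 * wave s θ x) := by
  refine D_eq_of_hasDerivWithinAt ?_
  have h : HasDerivAt (fun x : ℝ => s * cos (s * x + θ)) (-(s ^ 2 * wave s θ x)) x := by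
    have := (((hasDerivAt_id (x : ℝ)).const_mul s).add_const θ).cos.const_mul s
    exact this.congr_deriv (by simp only [id, wave]; ring)
  exact h.hasDerivWithinAt.congr_of_mem (ext_eqOn fun x => D_wave s θ x) x.2

theorem exists_eq_smul_wave {bL : Condition leftEnd} {bR : Condition rightEnd} {s : ℝ}
    (hs : 0 < s) {u : J → ℝ} (hu : u ∈ eigenspace bL bR (s ^ 2)) :
    ∃ C θ : ℝ, u = C • wave s θ := by
  have hU := hasDerivWithinAt_ext hu.1.1.one
  have hV := hasDerivWithinAt_ext hu.1.1.D
  have hsin : ∀ x : ℝ, HasDerivAt (fun x => sin (s * x)) (s * cos (s * x)) x := fun x =>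
    ((hasDerivAt_id x).const_mul s).sin.congr_deriv (by simp only [id]; ring)
  have hcos : ∀ x : ℝ, HasDerivAt (fun x => cos (s * x)) (-(s * sin (s * x))) x := fun x =>
    ((hasDerivAt_id x).const_mul s).cos.congr_deriv (by simp only [id]; ring)
  -- Rotating the vector `(u', s u)` back by the angle `s x` gives two first integrals. The polar
  -- form of the constant vector, divided by `s`, supplies amplitude and phase.
  have hP := eq_of_hasDerivWithinAt_zero
    (f := fun x => s * (ext u x * sin (s * x)) + ext (D u) x * cos (s * x)) fun x => by
      refine ((((hU x).mul (hsin x).hasDerivWithinAt).const_mul s).add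
        ((hV x).mul (hcos x).hasDerivWithinAt)).congr_deriv ?_
      rw [D_D_eq hu, ext_coe, ext_coe]
      ring
  have hQ := eq_of_hasDerivWithinAt_zero
    (f := fun x => s * (ext u x * cos (s * x)) - ext (D u) x * sin (s * x)) fun x => by
      refine ((((hU x).mul (hcos x).hasDerivWithinAt).const_mul s).sub
        ((hV x).mul (hsin x).hasDerivWithinAt)).congr_deriv ?_
      rw [D_D_eq hu, ext_coe, ext_coe]
      ring
  simp only [ext_coe] at hP hQ
  set z : ℂ := ⟨(s * (u leftEnd * sin (s * leftEnd)) + D u leftEnd * cos (s * leftEnd)) / s,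
    (s * (u leftEnd * cos (s * leftEnd)) - D u leftEnd * sin (s * leftEnd)) / s⟩ with hz
  have h1 : z.re * s = s * (u leftEnd * sin (s * leftEnd)) + D u leftEnd * cos (s * leftEnd) := by
    simp only [hz]; field_simp
  have h2 : z.im * s = s * (u leftEnd * cos (s * leftEnd)) - D u leftEnd * sin (s * leftEnd) := by
    simp only [hz]; field_simp
  refine ⟨‖z‖, z.arg, funext fun x => ?_⟩
  have h3 := hP x leftEnd
  have h4 := hQ x leftEnd
  rw [← h1, ← Complex.norm_mul_cos_arg] at h3
  rw [← h2, ← Complex.norm_mul_sin_arg] at h4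
  simp only [Pi.smul_apply, smul_eq_mul, wave]
  refine mul_left_cancel₀ hs.ne' ?_
  rw [sin_add]
  linear_combination sin (s * x) * h3 + cos (s * x) * h4
    - s * u x * sin_sq_add_cos_sq (s * x)

end Wave

/-! ### Boundary conditions as phase equations, and the end point estimate for the maximum
principle. -/

namespace Condition

/-- The data of a condition at `-1`. -/
noncomputable def leftData (b : Condition leftEnd) : MultiPointData :=
  ⟨b.m, b.α₀, -b.β₀, b.α, b.β, fun i => b.η i⟩

/-- The data of a condition at `1`, reflected to `-1`. -/
noncomputable def rightData (b : Condition rightEnd) : MultiPointData :=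
  ⟨b.m, b.α₀, b.β₀, b.α, fun i => -b.β i, fun i => -b.η i⟩

theorem leftData_admissible {b : Condition leftEnd} (h₁ : b.Nondegenerate)
    (h₂ : b.SignCondition) (h₃ : b.Small) : b.leftData.Admissible := by
  have h : 0 ≤ -b.β₀ := by simpa [SignCondition, leftEnd] using h₂
  refine ⟨h₁.1, h, ?_, h₃.1, fun h => h₃.2.1 (neg_eq_zero.1 h), ?_, fun i => abs_le.2 (b.η i).2⟩
  · have := h₁.2
    rwa [← abs_neg, abs_of_nonneg h] at this
  · have := h₃.2.2
    rwa [← neg_sq ((∑ i, |b.β i|) / b.β₀), ← div_neg] at this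

theorem rightData_admissible {b : Condition rightEnd} (h₁ : b.Nondegenerate)
    (h₂ : b.SignCondition) (h₃ : b.Small) : b.rightData.Admissible := by
  have h : 0 ≤ b.β₀ := by simpa [SignCondition, rightEnd] using h₂
  refine ⟨h₁.1, h, ?_, h₃.1, ?_, ?_, fun i => ?_⟩
  · have := h₁.2
    rwa [abs_of_nonneg h] at this
  · change b.β₀ = 0 → ∑ i : Fin b.m, |-b.β i| = 0
    simpa only [abs_neg] using h₃.2.1
  · change ((∑ i : Fin b.m, |b.α i|) / b.α₀) ^ 2 + ((∑ i : Fin b.m, |-b.β i|) / b.β₀) ^ 2 < 1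
    simpa only [abs_neg] using h₃.2.2
  · simpa [rightData] using abs_le.2 (b.η i).2

theorem holds_wave_left (b : Condition leftEnd) (s θ : ℝ) :
    b.Holds (wave s θ) ↔ b.leftData.defect s θ = 0 := by
  rw [Holds, ← sub_eq_zero, ← Finset.sum_add_distrib]
  simp only [D_wave, MultiPointData.defect, leftData, wave, leftEnd]
  refine Eq.congr (congrArg₂ _ ?_ (Finset.sum_congr rfl fun i _ => ?_)) rfl
  · rw [show s * -1 + θ = θ - s by ring]; ring
  · rw [add_comm θ]; ring

theorem holds_wave_right (b : Condition rightEnd) (s θ : ℝ) :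
    b.Holds (wave s θ) ↔ b.rightData.defect s (π - θ) = 0 := by
  rw [Holds, ← sub_eq_zero, ← Finset.sum_add_distrib]
  -- The reflection `x ↦ -x` turns `sin (s x + θ)` into `sin (s x + (π - θ))` and changes the sign
  -- of derivatives.
  simp only [D_wave, MultiPointData.defect, rightData, wave, rightEnd]
  refine Eq.congr (congrArg₂ _ ?_ (Finset.sum_congr rfl fun i _ => ?_)) rfl
  · rw [show π - θ - s = π - (s * 1 + θ) by ring, sin_pi_sub, cos_pi_sub]; ring
  · rw [show π - θ + s * -(b.η i : ℝ) = π - (s * b.η i + θ) by ring, sin_pi_sub, cos_pi_sub]; ring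

theorem sum_abs_α_le {e : J} {b : Condition e} (h₁ : b.Nondegenerate) (h₃ : b.Small) :
    ∑ i, |b.α i| ≤ b.α₀ ∧ (0 < b.α₀ → ∑ i, |b.α i| < b.α₀) := by
  have key : 0 < b.α₀ → ∑ i, |b.α i| < b.α₀ := fun h => by
    have h1 : (∑ i, |b.α i|) / b.α₀ < 1 := by
      have := h₃.2.2
      have h2 := sq_nonneg ((∑ i, |b.β i|) / b.β₀)
      nlinarith
    rwa [div_lt_one h] at h1
  refine ⟨?_, key⟩
  rcases h₁.1.eq_or_lt with h | h
  · rw [h₃.1 h.symm, h]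
  · exact (key h).le

theorem sum_abs_β_le {e : J} {b : Condition e} (h₃ : b.Small) :
    ∑ i, |b.β i| ≤ |b.β₀| ∧ (0 < |b.β₀| → ∑ i, |b.β i| < |b.β₀|) := by
  have key : 0 < |b.β₀| → ∑ i, |b.β i| < |b.β₀| := fun h => by
    have h1 : (∑ i, |b.β i|) / |b.β₀| < 1 := by
      have := h₃.2.2
      rw [← sq_abs ((∑ i, |b.β i|) / b.β₀), abs_div,
        abs_of_nonneg (Finset.sum_nonneg fun i _ => abs_nonneg (b.β i))] at this
      have h2 := sq_nonneg ((∑ i, |b.α i|) / b.α₀)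
      nlinarith
    rwa [div_lt_one h] at h1
  refine ⟨?_, key⟩
  rcases eq_or_ne b.β₀ 0 with h | h
  · rw [h₃.2.1 h, h, abs_zero]
  · exact (key (abs_pos.2 h)).le

/-- If `|u|` and `|u'|` attain their maxima at the end point of the condition, and `|u|` grows
towards it, then `u` vanishes or the condition is of Neumann type. -/
theorem eq_zero_of_max {e : J} {b : Condition e} (h₁ : b.Nondegenerate) (h₂ : b.SignCondition)
    (h₃ : b.Small) (he : (e : ℝ) ^ 2 = 1) {u : J → ℝ} (hb : b.Holds u)
    (hu : ∀ x, |u x| ≤ |u e|) (hu' : ∀ x, |D u x| ≤ |D u e|) (huu' : 0 ≤ (e : ℝ) * (u e * D u e)) :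
    u e = 0 ∨ b.α₀ = 0 ∧ D u e = 0 := by
  -- The sign condition and the growth towards `e` make both terms agree in sign, so nothing cancels
  -- on the left; the right side is smaller unless the relevant end value vanishes.
  have h : |b.α₀ * u e + b.β₀ * D u e| = |b.α₀ * u e| + |b.β₀ * D u e| := by
    rw [abs_add_eq_add_abs_iff, ← mul_nonneg_iff]
    have := mul_nonneg h₁.1 (mul_nonneg h₂ huu')
    linear_combination this + b.α₀ * b.β₀ * u e * D u e * he
  have h' : |b.α₀ * u e| + |b.β₀ * D u e|
      ≤ (∑ i, |b.α i|) * |u e| + (∑ i, |b.β i|) * |D u e| := by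
    rw [← h, hb, Finset.sum_mul, Finset.sum_mul]
    refine (abs_add_le _ _).trans (add_le_add ?_ ?_) <;>
    · refine (Finset.abs_sum_le_sum_abs _ _).trans (Finset.sum_le_sum fun i _ => ?_)
      rw [abs_mul]
      exact mul_le_mul_of_nonneg_left (by first | exact hu _ | exact hu' _) (abs_nonneg _)
  rw [abs_mul, abs_mul, abs_of_nonneg h₁.1] at h'
  obtain ⟨hα, hα'⟩ := sum_abs_α_le h₁ h₃
  obtain ⟨hβ, hβ'⟩ := sum_abs_β_le h₃
  have m1 := mul_le_mul_of_nonneg_right hα (abs_nonneg (u e))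
  have m2 := mul_le_mul_of_nonneg_right hβ (abs_nonneg (D u e))
  rcases h₁.1.eq_or_lt with h0 | h0
  · right
    refine ⟨h0.symm, ?_⟩
    by_contra hne
    have := hβ' (by simpa [← h0] using h₁.2)
    have := mul_lt_mul_of_pos_right this (abs_pos.2 hne)
    linarith
  · left
    by_contra hne
    have := mul_lt_mul_of_pos_right (hα' h0) (abs_pos.2 hne)
    linarith

end Condition

/-! ### The maximum principle for nonpositive `lam`. -/

section Nonpositive

/-- For `lam ≤ 0` the maxima of `|u|` and `|u'|` are attained at the same end point. -/
theorem max_at_end {bL : Condition leftEnd} {bR : Condition rightEnd} {lam : ℝ} (hlam : lam ≤ 0)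
    {u : J → ℝ} (hu : u ∈ eigenspace bL bR lam) :
    ∃ e : J, (e = leftEnd ∨ e = rightEnd) ∧ (∀ x, |u x| ≤ |u e|) ∧ (∀ x, |D u x| ≤ |D u e|) ∧
      0 ≤ (e : ℝ) * (u e * D u e) := by
  have hU := hasDerivWithinAt_ext hu.1.1.one
  have hV := hasDerivWithinAt_ext hu.1.1.D
  -- `(u u')' = u'² - lam u² ≥ 0`, so `u²` is convex and its maximum sits at an end point.
  have hUV : MonotoneOn (fun x => ext u x * ext (D u) x) (Icc (-1) 1) := by
    refine monotoneOn_of_hasDerivWithinAt_nonneg (f' := fun x => ext (D u) x ^ 2 - lam * ext u x ^ 2)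
      (convex_Icc _ _)
      (fun x hx => ((hU ⟨x, hx⟩).mul (hV ⟨x, hx⟩)).continuousWithinAt)
      (fun x hx => (((hU ⟨x, interior_subset hx⟩).mul (hV ⟨x, interior_subset hx⟩)).mono
        interior_subset).congr_deriv ?_) fun x hx => ?_
    · rw [D_D_eq hu, ← ext_coe u, ← ext_coe (D u)]
      ring
    nlinarith [mul_nonneg (neg_nonneg.2 hlam) (sq_nonneg (ext u x)), sq_nonneg (ext (D u) x)]
  have hsq : ∀ x : J, HasDerivWithinAt (fun x => ext u x ^ 2) (2 * (ext u x * ext (D u) x))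
      (Icc (-1) 1) x := fun x => by
    refine ((hU x).pow 2).congr_deriv ?_
    rw [ext_coe (D u)]
    ring
  have hsq' : ∀ x ∈ Ioo (-1 : ℝ) 1, HasDerivAt (fun x => ext u x ^ 2)
      (2 * (ext u x * ext (D u) x)) x := fun x hx =>
    (hsq ⟨x, Ioo_subset_Icc_self hx⟩).hasDerivAt (Icc_mem_nhds hx.1 hx.2)
  have hcont : ContinuousOn (fun x => ext u x ^ 2) (Icc (-1) 1) := fun x hx =>
    (hsq ⟨x, hx⟩).continuousWithinAt
  have hconv : ConvexOn ℝ (Icc (-1) 1) (fun x => ext u x ^ 2) := by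
    refine MonotoneOn.convexOn_of_deriv (convex_Icc _ _) hcont ?_ ?_ <;> rw [interior_Icc]
    · exact fun x hx => (hsq' x hx).differentiableAt.differentiableWithinAt
    · intro x hx y hy hxy
      rw [(hsq' x hx).deriv, (hsq' y hy).deriv]
      exact mul_le_mul_of_nonneg_left
        (hUV (Ioo_subset_Icc_self hx) (Ioo_subset_Icc_self hy) hxy) two_pos.le
  have hmax : ∀ x : J, u x ^ 2 ≤ max (u leftEnd ^ 2) (u rightEnd ^ 2) := fun x => by
    have := hconv.le_max_of_mem_Icc leftEnd.2 rightEnd.2 x.2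
    simpa only [ext_coe] using this
  -- The mean value theorem gives a point where `u u'` has the sign of `u(1)² - u(-1)²`;
  -- monotonicity carries this sign to the end point with the larger value.
  obtain ⟨c, hc, hslope⟩ := exists_hasDerivAt_eq_slope (fun x => ext u x ^ 2) _
    (by norm_num : (-1 : ℝ) < 1) hcont hsq'
  have hslope' : 2 * (ext u c * ext (D u) c) = (u rightEnd ^ 2 - u leftEnd ^ 2) / 2 := by
    rw [hslope, ← ext_coe u, ← ext_coe u]
    norm_num [leftEnd, rightEnd]
  -- Energy conservation: `u'² + lam u²` is constant, so for `lam ≤ 0` the maxima of `u²` are also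
  -- maxima of `u'²`.
  have hE := eq_of_hasDerivWithinAt_zero
    (f := fun x => ext (D u) x ^ 2 + lam * ext u x ^ 2) fun x => by
      refine (((hV x).pow 2).add ((hsq x).const_mul lam)).congr_deriv ?_
      rw [D_D_eq hu, ext_coe, ext_coe]
      ring
  simp only [ext_coe] at hE
  have hD : ∀ e : J, (∀ x, u x ^ 2 ≤ u e ^ 2) → ∀ x, |D u x| ≤ |D u e| := fun e he x => by
    rw [← sq_le_sq]
    nlinarith [hE x e, mul_nonneg (neg_nonneg.2 hlam) (sub_nonneg.2 (he x))]
  rcases le_total (u leftEnd ^ 2) (u rightEnd ^ 2) with h | h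
  · have h0 : ∀ x, u x ^ 2 ≤ u rightEnd ^ 2 := fun x => max_eq_right h ▸ hmax x
    refine ⟨rightEnd, Or.inr rfl, fun x => sq_le_sq.1 (h0 x), hD _ h0, ?_⟩
    have := hUV (Ioo_subset_Icc_self hc) rightEnd.2 hc.2.le
    simp only [ext_coe] at this
    simp only [rightEnd, one_mul] at this hslope' h ⊢
    linarith
  · have h0 : ∀ x, u x ^ 2 ≤ u leftEnd ^ 2 := fun x => max_eq_left h ▸ hmax x
    refine ⟨leftEnd, Or.inl rfl, fun x => sq_le_sq.1 (h0 x), hD _ h0, ?_⟩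
    have := hUV leftEnd.2 (Ioo_subset_Icc_self hc) hc.1.le
    simp only [ext_coe] at this
    simp only [leftEnd] at this hslope' h ⊢
    linarith

variable {bL : Condition leftEnd} {bR : Condition rightEnd}

/-- At the end point of the maxima, `u = 0` would make `u` vanish everywhere. Hence `u' = 0` there,
so `u' ≡ 0`, and a nonzero constant meets both conditions only if both `α₀` vanish. -/
theorem eigenfunction_of_nonpos (hL₁ : bL.Nondegenerate) (hR₁ : bR.Nondegenerate)
    (hL₂ : bL.SignCondition) (hR₂ : bR.SignCondition) (hL₃ : bL.Small) (hR₃ : bR.Small)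
    {lam : ℝ} (hlam : lam ≤ 0) {u : J → ℝ} (hu : IsEigenfunction bL bR lam u) :
    lam = 0 ∧ bL.α₀ = 0 ∧ bR.α₀ = 0 ∧ ∃ c : ℝ, u = fun _ => c := by
  obtain ⟨hu, hne⟩ := hu
  have hl : (leftEnd : ℝ) ^ 2 = 1 := by norm_num [leftEnd]
  have hr : (rightEnd : ℝ) ^ 2 = 1 := by norm_num [rightEnd]
  obtain ⟨e, he, h1, h2, h3⟩ := max_at_end hlam hu
  have hcase : u e = 0 ∨ D u e = 0 := by
    rcases he with rfl | rfl
    · exact (Condition.eq_zero_of_max hL₁ hL₂ hL₃ hl hu.1.2.1 h1 h2 h3).imp_right And.right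
    · exact (Condition.eq_zero_of_max hR₁ hR₂ hR₃ hr hu.1.2.2 h1 h2 h3).imp_right And.right
  have hue : u e ≠ 0 := fun h0 => hne <| funext fun x => by simpa [h0] using h1 x
  have hDe := hcase.resolve_left hue
  have hD : ∀ x, D u x = 0 := fun x => by simpa [hDe] using h2 x
  have hconst : ∀ x y, u x = u y := fun x y => by
    have := eq_of_hasDerivWithinAt_zero (f := ext u)
      (fun x => by simpa [hD] using hasDerivWithinAt_ext hu.1.1.one x) x y
    simpa only [ext_coe] using this
  have hlam0 : lam = 0 := by
    have h4 := D_D_eq hu e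
    rw [show D u = 0 from funext hD, D_zero] at h4
    simpa [hue] using h4
  refine ⟨hlam0, ?_, ?_, u e, funext fun x => hconst x e⟩
  · refine ((Condition.eq_zero_of_max hL₁ hL₂ hL₃ hl hu.1.2.1 (fun x => (hconst x _).symm ▸ le_rfl)
      (fun x => by simp [hD]) (by simp [hD])).resolve_left ?_).1
    rwa [hconst _ e]
  · refine ((Condition.eq_zero_of_max hR₁ hR₂ hR₃ hr hu.1.2.2 (fun x => (hconst x _).symm ▸ le_rfl)
      (fun x => by simp [hD]) (by simp [hD])).resolve_left ?_).1
    rwa [hconst _ e]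

theorem D_const (c : ℝ) : D (fun _ => c) = 0 :=
  funext fun x => D_eq_of_hasDerivWithinAt (hasDerivWithinAt_const (x : ℝ) _ c)

theorem const_mem_eigenspace (hL₃ : bL.Small) (hR₃ : bR.Small) (hL : bL.α₀ = 0)
    (hR : bR.α₀ = 0) (c : ℝ) : (fun _ => c) ∈ eigenspace bL bR 0 := by
  have key : ∀ {e : J} (b : Condition e), b.Small → b.α₀ = 0 → b.Holds fun _ => c := by
    intro e b h₃ h0
    have hα : ∀ i, b.α i = 0 := fun i => abs_eq_zero.1 <|
      (Finset.sum_eq_zero_iff_of_nonneg fun i _ => abs_nonneg (b.α i)).1 (h₃.1 h0) i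
        (Finset.mem_univ i)
    simp [Condition.Holds, D_const, h0, hα]
  exact ⟨⟨contDiffOn_const, key bL hL₃ hL, key bR hR₃ hR⟩, fun x _ => by simp [D_const, D_zero]⟩

end Nonpositive

end MultiPoint

end

/-! ### Matching the two phase shifts and counting the eigenvalues. -/

section

open Real Set Filter Topology

namespace MultiPoint

variable {bL : Condition leftEnd} {bR : Condition rightEnd}

theorem wave_mem_eigenspace_iff (s θ : ℝ) : wave s θ ∈ eigenspace bL bR (s ^ 2) ↔
    bL.leftData.defect s θ = 0 ∧ bR.rightData.defect s (π - θ) = 0 := by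
  rw [← bL.holds_wave_left, ← bR.holds_wave_right]
  exact ⟨fun h => h.1.2, fun h => ⟨⟨isC_wave 2 s θ, h⟩, fun x _ => by rw [D_D_wave, neg_neg]⟩⟩

theorem wave_add_int_mul_pi (s θ : ℝ) (n : ℤ) :
    wave s (θ + n * π) = ((-1 : ℝ) ^ n) • wave s θ := by
  funext x
  simp only [wave, Pi.smul_apply, smul_eq_mul, ← add_assoc, sin_add_int_mul_pi]

theorem wave_ne_zero {s : ℝ} (hs : s ≠ 0) (θ : ℝ) : wave s θ ≠ 0 := by
  intro h
  have h1 := congrFun h ⟨0, by norm_num, by norm_num⟩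
  have h2 := D_wave s θ ⟨0, by norm_num, by norm_num⟩
  rw [h, D_zero] at h2
  simp only [wave, Pi.zero_apply, mul_zero, zero_add, zero_eq_mul] at h1 h2
  have := sin_sq_add_cos_sq θ
  rw [h1, h2.resolve_left hs] at this
  norm_num at this

/-- The difference of the phase shifts required by the two boundary conditions. -/
noncomputable def shiftDiff (bL : Condition leftEnd) (bR : Condition rightEnd) (s : ℝ) : ℝ :=
  bL.leftData.shift s + bR.rightData.shift s - π

/-- The factor `lam^{1/2}` in the modified angle makes `(u', s u)` run on a circle of radius `s` at
constant speed. -/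
theorem isPruferAngle_wave {s : ℝ} (hs : 0 < s) {θ : ℝ} (h : θ - s ∈ Ioc (-π) π) :
    IsPruferAngle (s ^ 2) (wave s θ) fun x => s * x + θ := by
  refine ⟨by fun_prop, ?_, fun x => ?_⟩
  · simpa [leftEnd, neg_add_eq_sub] using h
  · have e : D (wave s θ) x ^ 2 + s ^ 2 * wave s θ x ^ 2 = s ^ 2 := by
      rw [D_wave, wave]
      linear_combination s ^ 2 * sin_sq_add_cos_sq (s * x + θ)
    rw [e, sqrt_sq hs.le, D_wave]
    exact ⟨rfl, rfl⟩

theorem wave_mem_Cs {s : ℝ} (hs : s ≠ 0) (θ : ℝ) : wave s θ ∈ Cs := by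
  refine ⟨isC_wave 1 s θ, fun x => ?_⟩
  by_contra! h
  have h1 : wave s θ x = 0 := abs_eq_zero.1 (le_antisymm (by linarith [abs_nonneg (D (wave s θ) x)])
    (abs_nonneg _))
  have h2 : D (wave s θ) x = 0 := abs_eq_zero.1
    (le_antisymm (by linarith [abs_nonneg (wave s θ x)]) (abs_nonneg _))
  rw [D_wave, mul_eq_zero, or_iff_right hs] at h2
  rw [wave] at h1
  have := sin_sq_add_cos_sq (s * x + θ)
  rw [h1, h2] at this
  norm_num at this

theorem angleLeft_eq {s : ℝ} (hs : 0 < s) : angleLeft bL (s ^ 2) = bL.leftData.phase s := by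
  simp only [angleLeft, MultiPointData.phase, Condition.leftData, sqrt_sq hs.le, mul_neg, neg_div,
    arctan_neg]

theorem angleRight_eq {s : ℝ} (hs : 0 < s) :
    angleRight bR (s ^ 2) = π - bR.rightData.phase s := by
  rw [show bR.rightData.phase s
      = if bR.α₀ = 0 then π / 2 else arctan (s * bR.β₀ / bR.α₀) from rfl, angleRight, sqrt_sq hs.le]
  split_ifs
  · ring
  · rfl

theorem shiftDiff_strictMonoOn (hL : bL.leftData.Admissible)
    (hR : bR.rightData.Admissible) : StrictMonoOn (shiftDiff bL bR) (Ioi 0) := fun s hs t ht h => by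
  have h1 := hL.strictMonoOn_shift hs ht h
  have h2 := hR.strictMonoOn_shift hs ht h
  unfold shiftDiff
  linarith

theorem shiftDiff_continuousOn (hL : bL.leftData.Admissible)
    (hR : bR.rightData.Admissible) : ContinuousOn (shiftDiff bL bR) (Ioi 0) :=
  (hL.continuousOn_shift.add hR.continuousOn_shift).sub continuousOn_const

theorem le_shiftDiff (hL : bL.leftData.Admissible)
    (hR : bR.rightData.Admissible) {s : ℝ} (hs : 0 < s) : 2 * s - 2 * π ≤ shiftDiff bL bR s := by
  have h1 := abs_lt.1 (MultiPointData.abs_shift_sub_lt (d := bL.leftData) s)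
  have h2 := abs_lt.1 (MultiPointData.abs_shift_sub_lt (d := bR.rightData) s)
  have h3 := hL.phase_nonneg hs
  have h4 := hR.phase_nonneg hs
  unfold shiftDiff
  linarith [h1.1, h2.1]

theorem tendsto_shiftDiff (hL : bL.leftData.Admissible)
    (hR : bR.rightData.Admissible) : Tendsto (shiftDiff bL bR) (𝓝[>] 0)
    (𝓝 ((if bL.α₀ = 0 then π / 2 else 0) + (if bR.α₀ = 0 then π / 2 else 0) - π)) :=
  (hL.tendsto_shift.add hR.tendsto_shift).sub_const π

theorem lt_shiftDiff (hL : bL.leftData.Admissible)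
    (hR : bR.rightData.Admissible) {l : ℝ} (hl : Tendsto (shiftDiff bL bR) (𝓝[>] 0) (𝓝 l)) {s : ℝ}
    (hs : 0 < s) : l < shiftDiff bL bR s := by
  have hmono := shiftDiff_strictMonoOn hL hR
  -- Passing to the limit gives only a weak inequality; the intermediate point `s / 2` restores
  -- strictness.
  have h1 : l ≤ shiftDiff bL bR (s / 2) := by
    refine le_of_tendsto hl ?_
    filter_upwards [Ioo_mem_nhdsGT (half_pos hs)] with t ht
    exact (hmono ht.1 (half_pos hs) ht.2).le
  exact h1.trans_lt (hmono (half_pos hs) hs (half_lt_self hs))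

theorem exists_shiftDiff_eq (hL : bL.leftData.Admissible)
    (hR : bR.rightData.Admissible) {l y : ℝ} (hl : Tendsto (shiftDiff bL bR) (𝓝[>] 0) (𝓝 l))
    (hy : l < y) : ∃ s, 0 < s ∧ shiftDiff bL bR s = y := by
  obtain ⟨s, hs1, hs2⟩ := ((hl.eventually_lt_const hy).and self_mem_nhdsWithin).exists
  have hs2 : 0 < s := hs2
  -- Large enough for the lower bound `2 t - 2 π` to exceed `y`.
  obtain ⟨t, ht⟩ : ∃ t, t = |y| + π + 1 := ⟨_, rfl⟩
  have ht0 : 0 < t := by rw [ht]; positivity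
  have ht1 : y ≤ shiftDiff bL bR t := by
    have := le_shiftDiff hL hR ht0
    linarith [le_abs_self y, abs_nonneg y]
  obtain ⟨r, hr, hry⟩ := isPreconnected_Ioi.intermediate_value (a := s) (b := t) hs2 ht0
    (shiftDiff_continuousOn hL hR) ⟨hs1.le, ht1⟩
  exact ⟨r, hr, hry⟩

theorem wave_mem_eigenspace (hL : bL.leftData.Admissible)
    (hR : bR.rightData.Admissible) {s : ℝ} (hs : 0 < s) {k : ℤ} (hk : shiftDiff bL bR s = k * π) :
    wave s (bL.leftData.shift s) ∈ eigenspace bL bR (s ^ 2) := by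
  rw [wave_mem_eigenspace_iff]
  refine ⟨hL.defect_shift hs, (hR.defect_eq_zero_iff hs _).2 ⟨-k, ?_⟩⟩
  unfold shiftDiff at hk
  push_cast
  linarith

theorem eq_smul_wave_of_mem (hL : bL.leftData.Admissible)
    (hR : bR.rightData.Admissible) {s : ℝ} (hs : 0 < s) {u : J → ℝ}
    (hu : u ∈ eigenspace bL bR (s ^ 2)) (hne : u ≠ 0) :
    (∃ k : ℤ, shiftDiff bL bR s = k * π) ∧ ∃ c : ℝ, u = c • wave s (bL.leftData.shift s) := by
  obtain ⟨C, θ, rfl⟩ := exists_eq_smul_wave hs hu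
  have hC : C ≠ 0 := fun h => hne (by rw [h, zero_smul])
  have hw : wave s θ ∈ eigenspace bL bR (s ^ 2) := (Submodule.smul_mem_iff _ hC).1 hu
  rw [wave_mem_eigenspace_iff, hL.defect_eq_zero_iff hs, hR.defect_eq_zero_iff hs] at hw
  obtain ⟨⟨n, hn⟩, m, hm⟩ := hw
  refine ⟨⟨-(n + m), ?_⟩, C * (-1) ^ n, ?_⟩
  · unfold shiftDiff
    push_cast
    linarith
  · rw [hn, wave_add_int_mul_pi, smul_smul]

theorem finrank_eigenspace (hL : bL.leftData.Admissible)
    (hR : bR.rightData.Admissible) {s : ℝ} (hs : 0 < s) {k : ℤ} (hk : shiftDiff bL bR s = k * π) :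
    Module.finrank ℝ (eigenspace bL bR (s ^ 2)) = 1 := by
  have hw := wave_mem_eigenspace hL hR hs hk
  refine finrank_eq_one_iff'.2 ⟨⟨_, hw⟩, fun h => wave_ne_zero hs.ne' _ (congrArg Subtype.val h), ?_⟩
  rintro ⟨u, hu⟩
  by_cases hne : u = 0
  · exact ⟨0, Subtype.ext (by simp [hne])⟩
  · obtain ⟨_, c, hc⟩ := eq_smul_wave_of_mem hL hR hs hu hne
    exact ⟨c, Subtype.ext hc.symm⟩

/-- The angle equals `shift_L - s` at `-1` and, by the matching equation, `k π + π - (shift_R - s)`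
at `1`. Both deviations from the reference angles are thus, up to sign, those bounded by
`abs_shift_sub_lt`. -/
theorem wave_mem_PPlus (hL : bL.leftData.Admissible) {s : ℝ} (hs : 0 < s) {k : ℕ} (hk : shiftDiff bL bR s = k * π) :
    (s ^ 2, wave s (bL.leftData.shift s)) ∈ PPlus bL bR k := by
  have h1 := MultiPointData.abs_shift_sub_lt (d := bL.leftData) s
  have h2 := MultiPointData.abs_shift_sub_lt (d := bR.rightData) s
  have h3 := hL.phase_nonneg hs
  have h4 := MultiPointData.Admissible.phase_le (d := bL.leftData) s
  refine ⟨by positivity, wave_mem_Cs hs.ne' _, _, isPruferAngle_wave hs ?_, ?_, ?_⟩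
  · have := abs_lt.1 h1
    constructor <;> linarith [this.1, this.2, pi_pos]
  · simpa [angleLeft_eq hs, leftEnd, neg_add_eq_sub] using h1
  · rw [← abs_neg] at h2
    convert h2 using 2
    unfold shiftDiff at hk
    simp only [angleRight_eq hs, rightEnd, ← hk]
    ring

theorem finrank_eigenspace_zero (hL₁ : bL.Nondegenerate) (hR₁ : bR.Nondegenerate)
    (hL₂ : bL.SignCondition) (hR₂ : bR.SignCondition) (hL₃ : bL.Small) (hR₃ : bR.Small)
    (hL : bL.α₀ = 0) (hR : bR.α₀ = 0) : Module.finrank ℝ (eigenspace bL bR 0) = 1 := by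
  refine finrank_eq_one_iff'.2 ⟨⟨_, const_mem_eigenspace hL₃ hR₃ hL hR 1⟩,
    fun h => one_ne_zero (congrFun (congrArg Subtype.val h) leftEnd), ?_⟩
  rintro ⟨u, hu⟩
  by_cases hne : u = 0
  · exact ⟨0, Subtype.ext (by simp [hne])⟩
  · obtain ⟨_, _, _, c, rfl⟩ :=
      eigenfunction_of_nonpos hL₁ hR₁ hL₂ hR₂ hL₃ hR₃ le_rfl ⟨hu, hne⟩
    exact ⟨c, Subtype.ext (funext fun _ => mul_one c)⟩

/-- The spectrum of the multi-point problem, with oscillation counts of the eigenfunctions. -/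
theorem spectrum_structure (hL₁ : bL.Nondegenerate) (hR₁ : bR.Nondegenerate)
    (hL₂ : bL.SignCondition) (hR₂ : bR.SignCondition)
    (hL₃ : bL.Small) (hR₃ : bR.Small) :
    ∃ lam : ℕ → ℝ,
      StrictMono lam ∧ (∀ k, 0 ≤ lam k) ∧
      spectrum bL bR = Set.range lam ∧
      Filter.Tendsto lam Filter.atTop Filter.atTop ∧
      (∀ k, Module.finrank ℝ (eigenspace bL bR (lam k)) = 1) ∧
      (∀ k, 0 < lam k → ∃ u : J → ℝ,
        IsEigenfunction bL bR (lam k) u ∧ (lam k, u) ∈ PPlus bL bR k) ∧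
      (bL.α₀ = 0 ∧ bR.α₀ = 0 → lam 0 = 0) ∧
      (0 < bL.α₀ + bR.α₀ → 0 < lam 0) := by
  have hL := Condition.leftData_admissible hL₁ hL₂ hL₃
  have hR := Condition.rightData_admissible hR₁ hR₂ hR₃
  have hlim := tendsto_shiftDiff hL hR
  obtain ⟨l, hl⟩ : ∃ l, l = (if bL.α₀ = 0 then π / 2 else 0)
    + (if bR.α₀ = 0 then π / 2 else 0) - π := ⟨_, rfl⟩
  rw [← hl] at hlim
  have hl_gt : -π ≤ l := by
    rw [hl]; split_ifs <;> linarith [pi_pos]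
  have hl_le : l ≤ 0 := by
    rw [hl]; split_ifs <;> linarith [pi_pos]
  have hl_zero : l = 0 ↔ bL.α₀ = 0 ∧ bR.α₀ = 0 := by
    rw [hl]
    split_ifs with h1 h2 h2 <;> simp only [h1, h2, and_self, and_true, and_false, iff_true,
      iff_false] <;> first | ring1 | (intro h; linarith [pi_pos])
  have hmono := shiftDiff_strictMonoOn hL hR
  -- The value `s = 0` stands for the constant eigenfunction, exactly when the level `0` is the
  -- unattained limit of `shiftDiff`.
  have hex : ∀ k : ℕ, ∃ s : ℝ, (0 < s ∧ shiftDiff bL bR s = k * π) ∨ (s = 0 ∧ k = 0 ∧ l = 0) := by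
    intro k
    by_cases hk : k = 0 ∧ l = 0
    · exact ⟨0, Or.inr ⟨rfl, hk⟩⟩
    · have hlt : l < k * π := by
        rcases Nat.eq_zero_or_pos k with h0 | h0
        · rw [h0, Nat.cast_zero, zero_mul]
          exact hl_le.lt_of_ne fun h => hk ⟨h0, h⟩
        · exact hl_le.trans_lt (by positivity)
      obtain ⟨s, hs⟩ := exists_shiftDiff_eq hL hR hlim hlt
      exact ⟨s, Or.inl hs⟩
  choose s hs using hex
  have hs0 : ∀ k, 0 ≤ s k := fun k => (hs k).elim (fun h => h.1.le) fun h => h.1.ge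
  have hspos : ∀ k, 0 < s k → shiftDiff bL bR (s k) = k * π := fun k h =>
    (hs k).elim And.right fun h' => absurd h'.1 h.ne'
  have hsucc : ∀ k, k ≠ 0 → 0 < s k := fun k h => (hs k).elim And.left fun h' => absurd h'.2.1 h
  have hsmono : StrictMono s := by
    intro j k hjk
    have hk := hsucc k (Nat.ne_zero_of_lt hjk)
    rcases (hs0 j).eq_or_lt with h | h
    · rwa [← h]
    · rw [← hmono.lt_iff_lt h hk, hspos j h, hspos k hk]
      exact mul_lt_mul_of_pos_right (Nat.cast_lt.2 hjk) pi_pos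
  have hstend : Tendsto s atTop atTop := by
    refine tendsto_atTop.2 fun M => ?_
    -- Monotonicity is available only for positive arguments, hence the truncation of `M` at `1`.
    have hM : 0 < max M 1 := lt_max_of_lt_right one_pos
    obtain ⟨n, hn⟩ := exists_nat_gt (shiftDiff bL bR (max M 1) / π)
    filter_upwards [eventually_gt_atTop 0, eventually_ge_atTop n] with k hk hnk
    refine (le_max_left M 1).trans ((hmono.le_iff_le hM (hsucc k hk.ne')).1 ?_)
    rw [hspos k (hsucc k hk.ne')]
    rw [div_lt_iff₀ pi_pos] at hn
    exact hn.le.trans (mul_le_mul_of_nonneg_right (Nat.cast_le.2 hnk) pi_pos.le)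
  have hfin : ∀ k, Module.finrank ℝ (eigenspace bL bR (s k ^ 2)) = 1 := by
    intro k
    rcases hs k with ⟨h, h'⟩ | ⟨h, -, h'⟩
    · exact finrank_eigenspace hL hR h (k := k) (by exact_mod_cast h')
    · rw [h, zero_pow two_ne_zero]
      exact finrank_eigenspace_zero hL₁ hR₁ hL₂ hR₂ hL₃ hR₃ (hl_zero.1 h').1 (hl_zero.1 h').2
  refine ⟨fun k => s k ^ 2, fun j k hjk => pow_lt_pow_left₀ (hsmono hjk) (hs0 j) two_ne_zero,
    fun k => sq_nonneg _, Set.Subset.antisymm ?_ ?_,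
    (tendsto_pow_atTop two_ne_zero).comp hstend, hfin, ?_, ?_, ?_⟩
  · rintro lam ⟨u, hu⟩
    rcases le_or_gt lam 0 with h | h
    · obtain ⟨rfl, h1, h2, -⟩ := eigenfunction_of_nonpos hL₁ hR₁ hL₂ hR₂ hL₃ hR₃ h hu
      refine ⟨0, ?_⟩
      have : s 0 = 0 := (hs 0).elim (fun h' => absurd (lt_shiftDiff hL hR hlim h'.1) (by
        rw [h'.2, hl_zero.2 ⟨h1, h2⟩]; simp)) And.left
      simp [this]
    · obtain ⟨t, ht⟩ : ∃ t, t = √lam := ⟨_, rfl⟩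
      have ht0 : 0 < t := ht ▸ sqrt_pos.2 h
      obtain rfl : lam = t ^ 2 := by rw [ht, sq_sqrt h.le]
      obtain ⟨⟨k, hk⟩, -⟩ := eq_smul_wave_of_mem hL hR ht0 hu.1 hu.2
      have hlt := lt_shiftDiff hL hR hlim ht0
      rw [hk] at hlt
      -- Negative levels do not occur: `k π > l ≥ -π`.
      have hk0 : -1 < k := by
        have : (-1 : ℝ) * π < k * π := by linarith
        exact_mod_cast lt_of_mul_lt_mul_right this pi_pos.le
      lift k to ℕ using by omega
      rw [Int.cast_natCast] at hk hlt
      refine ⟨k, ?_⟩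
      rcases hs k with h' | ⟨-, h0, h'⟩
      · have := hmono.injOn h'.1 ht0 (h'.2.trans hk.symm)
        simp only [this]
      · rw [h0, h'] at hlt
        simp at hlt
  · rintro _ ⟨k, rfl⟩
    obtain ⟨u, hu, -⟩ := finrank_eq_one_iff'.1 (hfin k)
    exact ⟨u, u.2, fun h => hu (Subtype.ext h)⟩
  · intro k hk
    have h : 0 < s k := (hs0 k).lt_of_ne' fun h => by simp [h] at hk
    exact ⟨_, ⟨wave_mem_eigenspace hL hR h (k := k) (by exact_mod_cast hspos k h),
      wave_ne_zero h.ne' _⟩, wave_mem_PPlus hL h (hspos k h)⟩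
  · intro h
    have : s 0 = 0 := (hs 0).elim (fun h' => absurd (lt_shiftDiff hL hR hlim h'.1) (by
      rw [h'.2, hl_zero.2 h]; simp)) And.left
    simp [this]
  · intro h
    refine (hs 0).elim (fun h' => pow_pos h'.1 2) fun h' => ?_
    obtain ⟨h1, h2⟩ := hl_zero.1 h'.2.2
    rw [h1, h2, add_zero] at h
    exact absurd h (lt_irrefl 0)

end MultiPoint

end

theorem theorem4p3 (bL : MultiPoint.Condition MultiPoint.leftEnd)
    (bR : MultiPoint.Condition MultiPoint.rightEnd)
    (hL₁ : bL.Nondegenerate) (hR₁ : bR.Nondegenerate)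
    (hL₂ : bL.SignCondition) (hR₂ : bR.SignCondition)
    (hL₃ : bL.Small) (hR₃ : bR.Small) :
    ∃ lam : ℕ → ℝ,
      StrictMono lam ∧ (∀ k, 0 ≤ lam k) ∧
      MultiPoint.spectrum bL bR = Set.range lam ∧
      Filter.Tendsto lam Filter.atTop Filter.atTop ∧
      (∀ k, Module.finrank ℝ (MultiPoint.eigenspace bL bR (lam k)) = 1) ∧
      (∀ k, 0 < lam k → ∃ u : MultiPoint.J → ℝ,
        MultiPoint.IsEigenfunction bL bR (lam k) u ∧ (lam k, u) ∈ MultiPoint.PPlus bL bR k) ∧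
      (bL.α₀ = 0 ∧ bR.α₀ = 0 → lam 0 = 0) ∧
      (0 < bL.α₀ + bR.α₀ → 0 < lam 0) :=
  MultiPoint.spectrum_structure hL₁ hR₁ hL₂ hR₂ hL₃ hR₃
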